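/- Let $\rho$ be a Borel probability measure on $\mathbb R$ which has an exponential moment, i.e. $\int e^{\eta|y|}\,d\rho(y)<\infty$ for some $\eta>0$, and a drift, i.e. $\lambda:=\int y\,d\rho(y)\neq 0$. Put $\widehat\rho(z)=\int e^{-zy}\,d\rho(y)$. For real $l\ge 0$ call $\rho$ $l$-weakly-diophantine if $$\liminf_{b\to\pm\infty}|b|^l\,|1-\widehat\rho(ib)|>0,$$ and weakly-diophantine if it is $l$-weakly-diophantine for some $l\ge 0$. Let $\tilde\rho$ be the image of $\rho$ under $y\mapsto -y$, let $G=\sum_{n\ge 0}\tilde\rho^{\star n}$, and let $T_\lambda$ be the measure with density $\frac1\lambda\mathbf 1_{(-\infty,0]}$ with respect to Lebesgue measure if $\lambda>0$, and with density $\frac1{|\lambda|}\mathbf 1_{[0,\infty)}$ if $\lambda<0$. For a measure $\mu$ write $\mu\star f(x)=\int f(x-y)\,d\mu(y)$, and $(G-T_\lambda)\star f=G\star f-T_\lambda\star f$. Let $\Omega$ be the set of even continuous functions $\omega:\mathbb R\to[1,\infty)$ such that $\lim_{x\to\pm\infty}e^{-\varepsilon|x|}\omega(x)=0$ for every $\varepsilon>0$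 and $$\sup_{\operatorname{Re}z>0,\ |z|\ge\delta}\left|\int_0^\infty\omega(x)e^{-zx}\,dx\right|<\infty\quad\text{for every }\delta>0.$$ For $\omega\in\Omega$ let $L^2_\omega(\mathbb R)$ be the space of (classes of) measurable functions $g:\mathbb R\to\mathbb C$ with $\int\omega|g|^2\,dx<\infty$, with its Hilbert norm, and let $C_c^\infty(\mathbb R)$ be the space of complex-valued test functions with its usual inductive limit topology. Assume that $\rho$ is weakly-diophantine, but that there is a real $l>0$ such that $\rho$ is not $l$-weakly-diophantine. Let $\omega\in\Omega$ be such that $f\mapsto(G-T_\lambda)\star f$ maps $C_c^\infty(\mathbb R)$ into $L^2_\omega(\mathbb R)$ and is continuous. Then $\omega$ does not grow faster than every polynomial: there is $p\in\mathbb N$ such that $$\liminf_{x\to+\infty}\frac{\omega(x)}{x^p}=0.$$ -/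

import Mathlib

open MeasureTheory Filter Topology
open scoped ENNReal Distributions

noncomputable section

namespace Renewal

/-- The Fourier-Laplace transform `∫ exp (-z y) dρ(y)` of a measure on the real line. -/
def laplace (ρ : Measure ℝ) (z : ℂ) : ℂ :=
  ∫ y, Complex.exp (-z * (y : ℂ)) ∂ρ

/-- `ρ` has an exponential moment of some positive order. -/
def HasExpMoment (ρ : Measure ℝ) : Prop :=
  ∃ η : ℝ, 0 < η ∧ Integrable (fun y : ℝ => Real.exp (η * |y|)) ρ

/-- The mean of `ρ`. -/
def drift (ρ : Measure ℝ) : ℝ := ∫ y, y ∂ρ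

/-- `ρ` has a drift: it has a finite first moment and its mean does not vanish. -/
def HasDrift (ρ : Measure ℝ) : Prop :=
  Integrable (fun y : ℝ => y) ρ ∧ drift ρ ≠ 0

/-- `l`-weakly-diophantine: `liminf_{b → ±∞} |b|^l |1 - ρ̂(ib)| > 0`. The lower limit is taken in
`[0, ∞]`, so that it is meaningful when the quantity is unbounded. -/
def IsWeaklyDiophantineOfOrder (ρ : Measure ℝ) (l : ℝ) : Prop :=
  0 < liminf (fun b : ℝ =>
      ENNReal.ofReal (|b| ^ l * ‖1 - laplace ρ (Complex.I * (b : ℂ))‖)) (atBot ⊔ atTop)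

/-- Weakly-diophantine: `l`-weakly-diophantine for some real `l ≥ 0`. -/
def IsWeaklyDiophantine (ρ : Measure ℝ) : Prop :=
  ∃ l : ℝ, 0 ≤ l ∧ IsWeaklyDiophantineOfOrder ρ l

/-- Convolution powers of a measure on the real line. -/
def convPower (μ : Measure ℝ) : ℕ → Measure ℝ
  | 0 => Measure.dirac 0
  | n + 1 => μ.conv (convPower μ n)

/-- The Green kernel: the sum of all convolution powers of the image of `ρ` under `y ↦ -y`. -/
def green (ρ : Measure ℝ) : Measure ℝ :=
  Measure.sum fun n : ℕ => convPower (ρ.map fun y : ℝ => -y) n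

/-- The limit kernel of the renewal theorem: Lebesgue measure with density `1/|lam|` on the
half-line where `lam * u ≤ 0`. For `lam > 0` it has density `1/lam` on `(-∞, 0]`; for `lam < 0`
it is the mirror image of the kernel for `-lam`. -/
def limitKernel (lam : ℝ) : Measure ℝ :=
  ENNReal.ofReal (1 / |lam|) • volume.restrict {u : ℝ | lam * u ≤ 0}

/-- `(G - T_lam) ⋆ f`, with `lam` the drift of `ρ` and `(μ ⋆ f)(x) = ∫ f (x - y) dμ(y)`. -/
def renewalError (ρ : Measure ℝ) (f : ℝ → ℂ) (x : ℝ) : ℂ :=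
  (∫ y, f (x - y) ∂(green ρ)) - ∫ y, f (x - y) ∂(limitKernel (drift ρ))

/-- The class of weights. -/
structure IsWeight (ω : ℝ → ℝ) : Prop where
  continuous : Continuous ω
  one_le : ∀ x, 1 ≤ ω x
  even : ∀ x, ω (-x) = ω x
  subexponential : ∀ ε : ℝ, 0 < ε →
    Tendsto (fun x : ℝ => Real.exp (-ε * |x|) * ω x) (atBot ⊔ atTop) (𝓝 0)
  laplace_bounded : ∀ δ : ℝ, 0 < δ → ∃ C : ℝ, ∀ z : ℂ, 0 < z.re → δ ≤ ‖z‖ →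
    ‖∫ x in Set.Ioi (0 : ℝ), (ω x : ℂ) * Complex.exp (-z * (x : ℂ))‖ ≤ C

/-- The measure `ω(x) dx`; `Lp ℂ 2` of it is the space of functions with `∫ ω |g|² < ∞`. -/
def weighted (ω : ℝ → ℝ) : Measure ℝ :=
  volume.withDensity fun x => ENNReal.ofReal (ω x)

/-- `f ↦ (G - T_lam) ⋆ f` maps smooth compactly supported complex functions into the weighted
`L²` space and is continuous for the usual inductive limit topology on test functions. -/
def IsContinuousIntoWeightedL2 (ρ : Measure ℝ) (ω : ℝ → ℝ) : Prop :=
  ∃ h : ∀ f : 𝓓((⊤ : TopologicalSpace.Opens ℝ), ℂ), MemLp (renewalError ρ f) 2 (weighted ω),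
    Continuous fun f : 𝓓((⊤ : TopologicalSpace.Opens ℝ), ℂ) => (h f).toLp (renewalError ρ f)

end Renewal

end

/-! Suppose `ω` beats every polynomial. Continuity on a fixed compact set gives one order `k` such
that data bounded in `C^k` have renewal errors in the unit ball of `L²_ω`, hence with bounded
moments of every order (`IsContinuousIntoWeightedL2.exists_bound`, `IsWeight.exists_moment_bound`).
Apply this to derivatives of wave packets of frequency `-b`, divided by `|b| ^ (k + 1)`. Being
derivatives, they have compactly supported images under the limit kernel, so the solution `u = G ⋆
f` itself has moments bounded uniformly in `b` (`exists_renewal_solution`).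

On the Fourier side `D U = F` with `D = 1 - ρ̂(i·)`. All derivatives of `U` are bounded uniformly in
`b`, while `F(b)` has size `|b| ^ (-k)`. Where `D` is small, `D'` is close to `i λ ≠ 0`
(`tendsto_deriv_charDefect`), so `U` behaves as near a simple pole: its `n`-th derivative at `b` is
comparable to `F(b) / D(b) ^ (n + 1)` (`tendsto_pow_mul_iteratedDeriv_div`). Hence `|D(b)|` is at
least of order `|b| ^ (-k / (n + 1))`. Since `k` does not depend on `n`, a large `n` contradicts the
failure of the diophantine condition of order `l`. -/

namespace Renewal

/-! ### Fourier integrals with moments; derivatives near an approximate simple zero. -/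

/-- The Fourier integral `∫ u(x) exp (i s x) dμ(x)` of a function against a measure. -/
noncomputable def fourierInt (μ : Measure ℝ) (u : ℝ → ℂ) (s : ℝ) : ℂ :=
  ∫ x, u x * Complex.exp (Complex.I * s * x) ∂μ

/-- All moments of `u` with respect to `μ` are finite. -/
def HasMoments (μ : Measure ℝ) (u : ℝ → ℂ) : Prop :=
  ∀ n : ℕ, Integrable (fun x : ℝ => (x : ℂ) ^ n * u x) μ

lemma norm_exp_I_mul_mul (s x : ℝ) : ‖Complex.exp (Complex.I * s * x)‖ = 1 := by
  rw [show Complex.I * s * x = ((s * x : ℝ) : ℂ) * Complex.I by push_cast; ring]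
  exact Complex.norm_exp_ofReal_mul_I _

lemma HasMoments.integrable {μ : Measure ℝ} {u : ℝ → ℂ} (hu : HasMoments μ u) :
    Integrable u μ := by
  simpa using hu 0

lemma HasMoments.mul_I_mul {μ : Measure ℝ} {u : ℝ → ℂ} (hu : HasMoments μ u) :
    HasMoments μ fun x => Complex.I * x * u x := by
  intro n
  refine ((hu (n + 1)).const_mul Complex.I).congr (ae_of_all _ fun x => ?_)
  ring

lemma HasMoments.hasDerivAt_fourierInt {μ : Measure ℝ} {u : ℝ → ℂ} (hu : HasMoments μ u) (s : ℝ) :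
    HasDerivAt (fourierInt μ u) (fourierInt μ (fun x => Complex.I * x * u x) s) s := by
  have hexp : ∀ s : ℝ, Continuous fun x : ℝ => Complex.exp (Complex.I * s * x) := by
    intro s; fun_prop
  refine (hasDerivAt_integral_of_dominated_loc_of_deriv_le (μ := μ) (s := Set.univ)
    (F := fun (s : ℝ) (x : ℝ) => u x * Complex.exp (Complex.I * s * x))
    (F' := fun (s : ℝ) (x : ℝ) => Complex.I * x * u x * Complex.exp (Complex.I * s * x))
    (bound := fun x => ‖(x : ℂ) ^ 1 * u x‖) Filter.univ_mem ?_ ?_ ?_ ?_ ?_ ?_).2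
  · exact Eventually.of_forall fun s =>
      hu.integrable.aestronglyMeasurable.mul (hexp s).aestronglyMeasurable
  · refine hu.integrable.mono
      (hu.integrable.aestronglyMeasurable.mul (hexp s).aestronglyMeasurable)
      (ae_of_all _ fun x => ?_)
    rw [norm_mul, norm_exp_I_mul_mul, mul_one]
  · exact hu.mul_I_mul.integrable.aestronglyMeasurable.mul (hexp s).aestronglyMeasurable
  · refine ae_of_all _ fun x s _ => ?_
    rw [norm_mul, norm_exp_I_mul_mul, mul_one, mul_assoc, norm_mul, Complex.norm_I, one_mul,
      pow_one]
  · exact (hu 1).norm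
  · refine ae_of_all _ fun x s _ => ?_
    have h1 : HasDerivAt (fun s : ℝ => Complex.I * (s : ℂ) * x) (Complex.I * 1 * x) s :=
      ((Complex.ofRealCLM.hasDerivAt (x := s)).const_mul Complex.I).mul_const (x : ℂ)
    refine (h1.cexp.const_mul (u x)).congr_deriv ?_
    ring

lemma HasMoments.iteratedDeriv_fourierInt {μ : Measure ℝ} (n : ℕ) {u : ℝ → ℂ}
    (hu : HasMoments μ u) :
    iteratedDeriv n (fourierInt μ u) = fourierInt μ fun x => (Complex.I * x) ^ n * u x := by
  induction n generalizing u with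
  | zero => simp
  | succ n ih =>
    rw [iteratedDeriv_succ', show deriv (fourierInt μ u) = _ from
      funext fun s => (hu.hasDerivAt_fourierInt s).deriv, ih hu.mul_I_mul]
    congr 1
    funext x
    ring

lemma HasMoments.contDiff_fourierInt {μ : Measure ℝ} {u : ℝ → ℂ} (hu : HasMoments μ u) (n : ℕ) :
    ContDiff ℝ n (fourierInt μ u) := by
  induction n generalizing u with
  | zero =>
    exact contDiff_zero.2 (continuous_iff_continuousAt.2 fun s =>
      (hu.hasDerivAt_fourierInt s).continuousAt)
  | succ n ih =>
    rw [Nat.cast_add, Nat.cast_one, contDiff_succ_iff_deriv]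
    refine ⟨fun s => (hu.hasDerivAt_fourierInt s).differentiableAt, by simp, ?_⟩
    rw [show deriv (fourierInt μ u) = _ from
      funext fun s => (hu.hasDerivAt_fourierInt s).deriv]
    exact ih hu.mul_I_mul

lemma norm_fourierInt_le (μ : Measure ℝ) (u : ℝ → ℂ) (s : ℝ) :
    ‖fourierInt μ u s‖ ≤ ∫ x, ‖u x‖ ∂μ := by
  refine (norm_integral_le_integral_norm _).trans_eq ?_
  simp_rw [norm_mul, norm_exp_I_mul_mul, mul_one]

lemma HasMoments.norm_iteratedDeriv_fourierInt_le {μ : Measure ℝ} {u : ℝ → ℂ}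
    (hu : HasMoments μ u) (n : ℕ) (s : ℝ) :
    ‖iteratedDeriv n (fourierInt μ u) s‖ ≤ ∫ x, |x| ^ n * ‖u x‖ ∂μ := by
  rw [hu.iteratedDeriv_fourierInt]
  refine (norm_fourierInt_le _ _ _).trans_eq ?_
  simp [norm_pow]

/-- If `D U = F` for smooth functions depending on a parameter, and `D` has an approximate simple
zero along a filter of parameters, then the derivatives of `U` grow like those of a simple pole. -/
lemma tendsto_pow_mul_iteratedDeriv_div {l : Filter ℝ} {D : ℝ → ℂ} {U F : ℝ → ℝ → ℂ} {d : ℂ}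
    (hd : d ≠ 0) (hDs : ∀ n : ℕ, ContDiff ℝ n D) (hUs : ∀ᶠ b in l, ∀ n : ℕ, ContDiff ℝ n (U b))
    (hDU : ∀ᶠ b in l, D * U b = F b) (hF0 : ∀ᶠ b in l, F b b ≠ 0)
    (hD0 : Tendsto D l (𝓝 0)) (hD1 : Tendsto (deriv D) l (𝓝 d))
    (hDb : ∀ n, ∃ C, ∀ s, ‖iteratedDeriv n D s‖ ≤ C)
    (hFb : ∀ n, ∃ C, ∀ᶠ b in l, ‖iteratedDeriv n (F b) b / F b b‖ ≤ C) (n : ℕ) :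
    ∃ L : ℂ, L ≠ 0 ∧
      Tendsto (fun b => D b ^ (n + 1) * iteratedDeriv n (U b) b / F b b) l (𝓝 L) := by
  induction n using Nat.strong_induction_on with
  | _ n ih =>
  cases n with
  | zero =>
    refine ⟨1, one_ne_zero, tendsto_const_nhds.congr' ?_⟩
    filter_upwards [hDU, hF0] with b h1 h2
    rw [← h1] at h2 ⊢
    simp only [Pi.mul_apply, zero_add, pow_one, iteratedDeriv_zero] at h2 ⊢
    exact (div_self h2).symm
  | succ m =>
    choose! L hL0 hL using ih
    -- Only the term `i = 0` survives, so the limits satisfy `L (m + 1) = -(m + 1) d L m`. The sum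
    -- is kept so that limits can be taken term by term.
    refine ⟨0 - ∑ i ∈ Finset.range (m + 1), if i = 0 then (m + 1 : ℂ) * d * L m else 0, ?_, ?_⟩
    · rw [Finset.sum_ite_eq' (Finset.range (m + 1)) 0]
      simp only [Finset.mem_range, Nat.succ_pos, if_true, zero_sub, ne_eq, neg_eq_zero]
      exact mul_ne_zero (mul_ne_zero (by exact_mod_cast Nat.succ_ne_zero m) hd)
        (hL0 m (Nat.lt_succ_self m))
    have hbdd : ∀ {f g : ℝ → ℂ}, Tendsto f l (𝓝 0) → (∃ C, ∀ᶠ b in l, ‖g b‖ ≤ C) →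
        Tendsto (fun b => f b * g b) l (𝓝 0) := fun hf ⟨C, hC⟩ =>
      hf.zero_mul_isBoundedUnder_le ⟨C, eventually_map.2 hC⟩
    -- Leibniz for `D * U = F`, multiplied by `D ^ (m + 1) / F` and solved for the top derivative of
    -- `U`. Splitting `D ^ (m + 1)` as `D ^ i * D ^ (m - i + 1)` leaves in each term a quotient with
    -- known limit and a factor `D ^ i`, which vanishes in the limit when `i > 0`.
    have key : (fun b => D b ^ (m + 1) * (iteratedDeriv (m + 1) (F b) b / F b b) -
        ∑ i ∈ Finset.range (m + 1), ((m + 1).choose (i + 1) : ℂ) * (D b ^ i *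
          iteratedDeriv (i + 1) D b) * (D b ^ (m - i + 1) * iteratedDeriv (m - i) (U b) b / F b b))
        =ᶠ[l] fun b => D b ^ (m + 1 + 1) * iteratedDeriv (m + 1) (U b) b / F b b := by
      filter_upwards [hDU, hUs] with b h1 h2
      conv_lhs => rw [← h1, iteratedDeriv_mul (hDs _).contDiffAt (h2 _).contDiffAt,
        Finset.sum_range_succ']
      rw [h1]
      simp only [Nat.choose_zero_right, Nat.cast_one, one_mul, iteratedDeriv_zero, Nat.sub_zero,
        Nat.add_sub_add_right]
      rw [add_div, mul_add, Finset.sum_div, Finset.mul_sum, add_sub_right_comm,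
        ← Finset.sum_sub_distrib, Finset.sum_eq_zero, zero_add]
      · ring
      · intro i hi
        have hi' : D b ^ (m + 1) = D b ^ i * D b ^ (m - i + 1) := by
          rw [← pow_add]
          congr 1
          have := Finset.mem_range.1 hi
          omega
        rw [hi']
        ring
    refine Tendsto.congr' key (Tendsto.sub ?_ (tendsto_finsetSum _ fun i hi => ?_))
    · refine hbdd ?_ (hFb (m + 1))
      simpa using hD0.pow (m + 1)
    · by_cases h0 : i = 0
      · subst h0
        simp only [if_true, zero_add, Nat.choose_one_right, pow_zero, one_mul, Nat.sub_zero,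
          iteratedDeriv_one]
        simpa using (hD1.const_mul ((m + 1 : ℕ) : ℂ)).mul (hL m (Nat.lt_succ_self m))
      · rw [if_neg h0]
        have h1 : Tendsto (fun b => D b ^ i * iteratedDeriv (i + 1) D b) l (𝓝 0) := by
          refine hbdd (by simpa [h0] using hD0.pow i) ?_
          obtain ⟨C, hC⟩ := hDb (i + 1)
          exact ⟨C, Eventually.of_forall fun b => hC b⟩
        have h2 := (h1.const_mul ((m + 1).choose (i + 1) : ℂ)).mul
          (hL (m - i) (by omega))
        simpa using h2

end Renewal

/-! ### The Green kernel and the Poisson equation. -/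

namespace Renewal

instance isProbabilityMeasure_convPower (μ : Measure ℝ) [IsProbabilityMeasure μ] (n : ℕ) :
    IsProbabilityMeasure (convPower μ n) := by
  induction n with
  | zero => exact Measure.dirac.isProbabilityMeasure
  | succ n ih => simp only [convPower]; infer_instance

lemma lintegral_exp_convPower (μ : Measure ℝ) [IsProbabilityMeasure μ] (θ : ℝ) (n : ℕ) :
    ∫⁻ y, ENNReal.ofReal (Real.exp (θ * y)) ∂(convPower μ n) =
      (∫⁻ y, ENNReal.ofReal (Real.exp (θ * y)) ∂μ) ^ n := by
  induction n with
  | zero => simp [convPower]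
  | succ n ih =>
    rw [convPower, Measure.lintegral_conv (by fun_prop)]
    simp_rw [mul_add, Real.exp_add, ENNReal.ofReal_mul (Real.exp_pos _).le]
    simp_rw [lintegral_const_mul' _ _ ENNReal.ofReal_ne_top, ih]
    rw [lintegral_mul_const _ (by fun_prop), pow_succ']

instance isProbabilityMeasure_map_neg (ρ : Measure ℝ) [IsProbabilityMeasure ρ] :
    IsProbabilityMeasure (ρ.map fun y : ℝ => -y) :=
  Measure.isProbabilityMeasure_map (by fun_prop)

instance sFinite_green (ρ : Measure ℝ) [IsProbabilityMeasure ρ] : SFinite (green ρ) := by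
  unfold green; infer_instance

lemma sum_convPower_eq (μ : Measure ℝ) [IsProbabilityMeasure μ] :
    Measure.sum (convPower μ) = Measure.dirac 0 + μ.conv (Measure.sum (convPower μ)) := by
  have h : μ.conv (Measure.sum (convPower μ)) = Measure.sum fun n : ℕ => convPower μ (n + 1) := by
    unfold Measure.conv
    rw [Measure.prod_sum_right, Measure.map_sum (by fun_prop)]
    rfl
  rw [h]
  refine Measure.ext fun s hs => ?_
  rw [Measure.add_apply, Measure.sum_apply _ hs, Measure.sum_apply _ hs]
  exact tsum_eq_zero_add' (f := fun n => convPower μ n s) ENNReal.summable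

lemma green_eq_dirac_add_conv (ρ : Measure ℝ) [IsProbabilityMeasure ρ] :
    green ρ = Measure.dirac 0 + (ρ.map fun y : ℝ => -y).conv (green ρ) :=
  sum_convPower_eq _

/-- An exponential moment and a nonzero mean give a real exponent for which the Laplace transform
is less than one. -/
lemma exists_integral_exp_lt_one {ρ : Measure ℝ} [IsProbabilityMeasure ρ]
    (hexp : HasExpMoment ρ) (hdrift : HasDrift ρ) :
    ∃ θ : ℝ, Integrable (fun y => Real.exp (θ * y)) ρ ∧ ∫ y, Real.exp (θ * y) ∂ρ < 1 := by
  obtain ⟨η, hη, hint⟩ := hexp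
  have hint' : ∀ θ : ℝ, |θ| ≤ η → Integrable (fun y => Real.exp (θ * y)) ρ := by
    intro θ hθ
    refine hint.mono' (by fun_prop) (ae_of_all _ fun y => ?_)
    rw [Real.norm_eq_abs, Real.abs_exp]
    refine Real.exp_le_exp.2 ((le_abs_self _).trans ?_)
    rw [abs_mul]
    gcongr
  have h0 : (0 : ℝ) ∈ interior (ProbabilityTheory.integrableExpSet id ρ) := by
    refine mem_interior_iff_mem_nhds.2 (Filter.mem_of_superset (Metric.ball_mem_nhds 0 hη) ?_)
    intro θ hθ
    exact hint' θ (by simpa using (mem_ball_zero_iff.1 hθ).le)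
  have hder := ProbabilityTheory.hasDerivAt_mgf h0
  have hmean : ∫ y, id y * Real.exp (0 * id y) ∂ρ = drift ρ := by simp [drift]
  rw [hmean] at hder
  by_contra! hcon
  -- Otherwise the moment generating function, equal to 1 at 0, has a minimum there, and its
  -- derivative at 0 is the drift.
  have hmin : IsLocalMin (ProbabilityTheory.mgf id ρ) 0 := by
    filter_upwards [Metric.ball_mem_nhds (0 : ℝ) hη] with θ hθ
    rw [ProbabilityTheory.mgf_zero]
    exact hcon θ (hint' θ (by simpa using (mem_ball_zero_iff.1 hθ).le))
  exact hdrift.2 (hmin.hasDerivAt_eq_zero hder)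

/-- Against `exp (-θ y)` the convolution powers of the reflected measure form a convergent geometric
series, and a compactly supported continuous function is dominated by a multiple of this
exponential. -/
lemma integrable_green {ρ : Measure ℝ} [IsProbabilityMeasure ρ]
    (hexp : HasExpMoment ρ) (hdrift : HasDrift ρ) {f : ℝ → ℂ} (hf : Continuous f)
    (hfc : HasCompactSupport f) : Integrable f (green ρ) := by
  obtain ⟨θ, hθi, hθ⟩ := exists_integral_exp_lt_one hexp hdrift
  have hlint : ∫⁻ y, ENNReal.ofReal (Real.exp (-θ * y)) ∂(ρ.map fun y : ℝ => -y) < 1 := by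
    rw [lintegral_map (by fun_prop) (by fun_prop)]
    simp only [neg_mul_neg]
    rw [← ofReal_integral_eq_lintegral_ofReal hθi (ae_of_all _ fun y => (Real.exp_pos _).le)]
    exact ENNReal.ofReal_lt_one.2 hθ
  have hint : Integrable (fun y => Real.exp (-θ * y)) (green ρ) := by
    refine ⟨by fun_prop, ?_⟩
    rw [hasFiniteIntegral_iff_ofReal (ae_of_all _ fun y => (Real.exp_pos _).le), green,
      lintegral_sum_measure]
    simp_rw [lintegral_exp_convPower, ENNReal.tsum_geometric]
    exact ENNReal.inv_lt_top.2 (tsub_pos_of_lt hlint)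
  have hg : Continuous fun y => f y * Complex.exp (θ * y) := by fun_prop
  obtain ⟨C, hC⟩ := hg.bounded_above_of_compact_support hfc.mul_right
  refine (hint.const_mul C).mono' hf.aestronglyMeasurable (ae_of_all _ fun y => ?_)
  have := hC y
  rw [norm_mul, Complex.norm_exp, show ((θ : ℂ) * y).re = θ * y by simp] at this
  rwa [neg_mul, Real.exp_neg, ← div_eq_mul_inv, le_div_iff₀ (Real.exp_pos _)]

lemma hasCompactSupport_comp_sub {f : ℝ → ℂ} (hfc : HasCompactSupport f) (x : ℝ) :
    HasCompactSupport fun y => f (x - y) :=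
  hfc.comp_homeomorph (Homeomorph.subLeft x)

/-- The Green kernel solves the discrete Poisson equation. -/
lemma green_conv_sub {ρ : Measure ℝ} [IsProbabilityMeasure ρ]
    (hexp : HasExpMoment ρ) (hdrift : HasDrift ρ) {f : ℝ → ℂ} (hf : Continuous f)
    (hfc : HasCompactSupport f) (x : ℝ) :
    (∫ y, f (x - y) ∂(green ρ)) =
      f x + ∫ z, (∫ y, f (x - z - y) ∂(green ρ)) ∂(ρ.map fun y : ℝ => -y) := by
  have hint : Integrable (fun y => f (x - y)) (green ρ) :=
    integrable_green hexp hdrift (by fun_prop) (hasCompactSupport_comp_sub hfc x)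
  rw [green_eq_dirac_add_conv] at hint
  conv_lhs => rw [green_eq_dirac_add_conv]
  obtain ⟨h1, h2⟩ := integrable_add_measure.1 hint
  rw [integral_add_measure h1 h2, integral_dirac, integral_conv h2, sub_zero]
  simp_rw [sub_sub]

/-- The limit kernel applied to a derivative. -/
lemma limitKernel_conv_deriv {lam : ℝ} (hlam : lam ≠ 0) {h : ℝ → ℂ} (hh : ContDiff ℝ 1 h)
    (hhc : HasCompactSupport h) (x : ℝ) :
    ∫ y, deriv h (x - y) ∂(limitKernel lam) = -h x / lam := by
  have hd : ∀ y, deriv (fun y => h (x - y)) y = -deriv h (x - y) := fun y => by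
    rw [deriv_comp_const_sub]
  have hx : ContDiff ℝ 1 fun y => h (x - y) := by fun_prop
  have hxc := hasCompactSupport_comp_sub hhc x
  rw [limitKernel, integral_smul_measure, ENNReal.toReal_ofReal (by positivity)]
  rcases lt_or_gt_of_ne hlam with hl | hl
  · have hs : {u : ℝ | lam * u ≤ 0} = Set.Ici 0 := by
      ext u; simp [mul_nonpos_iff, hl.le, not_le.2 hl]
    have := hxc.integral_Ioi_deriv_eq hx 0
    simp only [hd, integral_neg, sub_zero, neg_inj] at this
    rw [hs, integral_Ici_eq_integral_Ioi, this, abs_of_neg hl, Complex.real_smul]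
    push_cast
    field_simp
  · have hs : {u : ℝ | lam * u ≤ 0} = Set.Iic 0 := by
      ext u; simp [mul_nonpos_iff, hl.le, not_le.2 hl]
    have := hxc.integral_Iic_deriv_eq hx 0
    simp only [hd, integral_neg, sub_zero, neg_eq_iff_eq_neg] at this
    rw [hs, this, abs_of_pos hl, Complex.real_smul]
    push_cast
    field_simp

end Renewal

/-! ### Modulated test functions. -/

namespace Renewal

section ContDiffScope

open scoped ContDiff

/-- The test function `φ` modulated to the frequency `-b`. -/
noncomputable def wavePacket (φ : ℝ → ℂ) (b x : ℝ) : ℂ :=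
  Complex.exp (Complex.I * ((-b : ℝ) : ℂ) * x) * φ x

lemma contDiff_exp_I_mul (b : ℝ) :
    ContDiff ℝ ∞ fun x : ℝ => Complex.exp (Complex.I * (b : ℂ) * x) :=
  (contDiff_const.mul Complex.ofRealCLM.contDiff).cexp

lemma contDiff_wavePacket {φ : ℝ → ℂ} (hφ : ContDiff ℝ ∞ φ) (b : ℝ) :
    ContDiff ℝ ∞ (wavePacket φ b) :=
  (contDiff_exp_I_mul (-b)).mul hφ

lemma hasDerivAt_exp_I_mul (b x : ℝ) :
    HasDerivAt (fun x : ℝ => Complex.exp (Complex.I * (b : ℂ) * x))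
      (Complex.I * b * Complex.exp (Complex.I * (b : ℂ) * x)) x := by
  have h : HasDerivAt (fun x : ℝ => Complex.I * (b : ℂ) * x) (Complex.I * b * 1) x :=
    (Complex.ofRealCLM.hasDerivAt (x := x)).const_mul (Complex.I * (b : ℂ))
  exact h.cexp.congr_deriv (by ring)

lemma norm_iteratedFDeriv_exp_I_mul (b : ℝ) (n : ℕ) (x : ℝ) :
    ‖iteratedFDeriv ℝ n (fun x : ℝ => Complex.exp (Complex.I * (b : ℂ) * x)) x‖ = |b| ^ n := by
  have h : iteratedDeriv n (fun x : ℝ => Complex.exp (Complex.I * (b : ℂ) * x)) =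
      fun x : ℝ => (Complex.I * b) ^ n * Complex.exp (Complex.I * (b : ℂ) * x) := by
    induction n with
    | zero => simp
    | succ n ih =>
      rw [iteratedDeriv_succ, ih]
      funext x
      rw [((hasDerivAt_exp_I_mul b x).const_mul _).deriv]
      ring
  rw [norm_iteratedFDeriv_eq_norm_iteratedDeriv, h]
  simp only [norm_mul, norm_exp_I_mul_mul, norm_pow, Complex.norm_I, Complex.norm_real,
    Real.norm_eq_abs, one_mul, mul_one]

lemma norm_iteratedFDeriv_wavePacket_le {φ : ℝ → ℂ} (hφ : ContDiff ℝ ∞ φ)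
    (hφc : HasCompactSupport φ) (n : ℕ) :
    ∃ C, ∀ b x : ℝ, 1 ≤ |b| → ‖iteratedFDeriv ℝ n (wavePacket φ b) x‖ ≤ C * |b| ^ n := by
  have hb : ∀ i : ℕ, ∃ C, ∀ x, ‖iteratedFDeriv ℝ i φ x‖ ≤ C := fun i =>
    (hφ.continuous_iteratedFDeriv (by exact_mod_cast le_top)).bounded_above_of_compact_support
      (hφc.iteratedFDeriv i)
  choose C hC using hb
  refine ⟨∑ i ∈ Finset.range (n + 1), (n.choose i : ℝ) * C (n - i), fun b x h1 => ?_⟩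
  refine (norm_iteratedFDeriv_mul_le (N := ∞) (contDiff_exp_I_mul (-b)) hφ x
    (by exact_mod_cast le_top)).trans ?_
  rw [Finset.sum_mul]
  refine Finset.sum_le_sum fun i hi => ?_
  rw [norm_iteratedFDeriv_exp_I_mul, abs_neg, mul_right_comm]
  have hpow : |b| ^ i ≤ |b| ^ n :=
    pow_le_pow_right₀ h1 (Nat.lt_succ_iff.1 (Finset.mem_range.1 hi))
  have h0 := (norm_nonneg _).trans (hC (n - i) x)
  gcongr
  exact hC _ x

lemma norm_iteratedFDeriv_deriv_wavePacket_le {φ : ℝ → ℂ} (hφ : ContDiff ℝ ∞ φ)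
    (hφc : HasCompactSupport φ) (n : ℕ) :
    ∃ C, ∀ b x : ℝ, 1 ≤ |b| →
      ‖iteratedFDeriv ℝ n (deriv (wavePacket φ b)) x‖ ≤ C * |b| ^ (n + 1) := by
  obtain ⟨C, hC⟩ := norm_iteratedFDeriv_wavePacket_le hφ hφc (n + 1)
  refine ⟨C, fun b x hb => ?_⟩
  rw [norm_iteratedFDeriv_eq_norm_iteratedDeriv, ← iteratedDeriv_succ',
    ← norm_iteratedFDeriv_eq_norm_iteratedDeriv]
  exact hC b x hb

lemma deriv_wavePacket {φ : ℝ → ℂ} (hφ : ContDiff ℝ ∞ φ) (b x : ℝ) :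
    deriv (wavePacket φ b) x =
      Complex.exp (Complex.I * ((-b : ℝ) : ℂ) * x) * (deriv φ x - Complex.I * b * φ x) := by
  have h := (hasDerivAt_exp_I_mul (-b) x).mul
    (hφ.differentiable (by simp) x).hasDerivAt
  refine Eq.trans h.deriv ?_
  push_cast
  ring

lemma norm_deriv_wavePacket_le {φ : ℝ → ℂ} (hφ : ContDiff ℝ ∞ φ) {b : ℝ} (hb : 1 ≤ |b|) (x : ℝ) :
    ‖deriv (wavePacket φ b) x‖ ≤ |b| * (‖deriv φ x‖ + ‖φ x‖) := by
  rw [deriv_wavePacket hφ, norm_mul, norm_exp_I_mul_mul, one_mul, mul_add]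
  refine (norm_sub_le _ _).trans (add_le_add ?_ ?_)
  · exact le_mul_of_one_le_left (norm_nonneg _) hb
  · simp

lemma hasMoments_of_hasCompactSupport {f : ℝ → ℂ} (hf : Continuous f) (hfc : HasCompactSupport f) :
    HasMoments volume f := fun n =>
  Continuous.integrable_of_hasCompactSupport (by fun_prop) hfc.mul_left

lemma hasCompactSupport_wavePacket {φ : ℝ → ℂ} (hφc : HasCompactSupport φ) (b : ℝ) :
    HasCompactSupport (wavePacket φ b) := hφc.mul_left

lemma continuous_deriv_of_contDiff {φ : ℝ → ℂ} (hφ : ContDiff ℝ ∞ φ) : Continuous (deriv φ) :=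
  hφ.continuous_deriv (by exact_mod_cast le_top)

lemma integrable_pow_mul_norm {f : ℝ → ℂ} (hf : Continuous f) (hfc : HasCompactSupport f) (n : ℕ) :
    Integrable fun x => |x| ^ n * ‖f x‖ := by
  simpa using (hasMoments_of_hasCompactSupport hf hfc n).norm

/-- Differentiating the Fourier integral brings down powers of `x`, not of `b`, so only the first
power of `|b|` appears for every `n`. This matches the size found in `fourierInt_deriv_wavePacket`
and keeps the ratios of derivatives of `F` to `F` bounded. -/
lemma integral_pow_mul_norm_deriv_wavePacket_le {φ : ℝ → ℂ} (hφ : ContDiff ℝ ∞ φ)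
    (hφc : HasCompactSupport φ) (n : ℕ) :
    ∃ C, ∀ b : ℝ, 1 ≤ |b| → ∫ x, |x| ^ n * ‖deriv (wavePacket φ b) x‖ ≤ C * |b| := by
  have h1 := integrable_pow_mul_norm (continuous_deriv_of_contDiff hφ) hφc.deriv n
  have h2 := integrable_pow_mul_norm hφ.continuous hφc n
  refine ⟨∫ x, (|x| ^ n * ‖deriv φ x‖ + |x| ^ n * ‖φ x‖), fun b hb => ?_⟩
  rw [← integral_mul_const]
  refine integral_mono (integrable_pow_mul_norm
    (continuous_deriv_of_contDiff (contDiff_wavePacket hφ b))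
    (hasCompactSupport_wavePacket hφc b).deriv n) ((h1.add h2).mul_const _) fun x => ?_
  refine (mul_le_mul_of_nonneg_left (norm_deriv_wavePacket_le hφ hb x) (by positivity)).trans_eq ?_
  ring

lemma fourierInt_deriv_wavePacket {φ : ℝ → ℂ} (hφ : ContDiff ℝ ∞ φ)
    (hφc : HasCompactSupport φ) (b : ℝ) :
    fourierInt volume (deriv (wavePacket φ b)) b = -(Complex.I * b) * ∫ x, φ x := by
  have h1 : ∀ x : ℝ, deriv (wavePacket φ b) x * Complex.exp (Complex.I * b * x) =
      deriv φ x - Complex.I * b * φ x := by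
    intro x
    rw [deriv_wavePacket hφ, mul_right_comm, ← Complex.exp_add]
    simp
  have hi := hφ.continuous.integrable_of_hasCompactSupport (μ := volume) hφc
  have hi' := (continuous_deriv_of_contDiff hφ).integrable_of_hasCompactSupport
    (μ := volume) hφc.deriv
  simp_rw [fourierInt, h1]
  rw [integral_sub hi' (hi.const_mul _), integral_eq_zero_of_hasDerivAt_of_integrable
    (fun x => (hφ.differentiable (by simp) x).hasDerivAt) hi' hi, integral_const_mul]
  ring

end ContDiffScope

/-! ### Quantitative continuity and moment bounds from the weight. -/

lemma toLp_eq_zero_of_eq_zero {μ : Measure ℝ} {g : ℝ → ℂ} (hg : MemLp g 2 μ) (h : g = 0) :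
    hg.toLp g = 0 := by
  subst h
  exact MemLp.toLp_zero hg

/-- Continuity on test functions yields a uniform bound on a neighbourhood of zero defined by
finitely many derivatives. -/
lemma IsContinuousIntoWeightedL2.exists_bound {ρ : Measure ℝ} {ω : ℝ → ℝ}
    (hcont : IsContinuousIntoWeightedL2 ρ ω) (K : TopologicalSpace.Compacts ℝ) :
    ∃ k : ℕ, ∃ r : ℝ, 0 < r ∧ ∀ f : ℝ → ℂ, ContDiff ℝ (⊤ : ℕ∞) f → Function.support f ⊆ K →
      (∀ i ≤ k, ∀ x, ‖iteratedFDeriv ℝ i f x‖ ≤ r) →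
        MemLp (renewalError ρ f) 2 (weighted ω) ∧
          eLpNorm (renewalError ρ f) 2 (weighted ω) ≤ 1 := by
  obtain ⟨h, hc⟩ := hcont
  have hK : (K : Set ℝ) ⊆ (⊤ : TopologicalSpace.Opens ℝ) := fun _ _ => trivial
  have hc' := hc.comp (TestFunction.continuous_ofSupportedIn (n := ⊤) (F := ℂ) hK)
  have h0 : renewalError ρ (0 : ℝ → ℂ) = 0 := by
    funext x; simp [renewalError]
  have hU := hc'.continuousAt.preimage_mem_nhds (x := 0) (Metric.closedBall_mem_nhds _ one_pos)
  obtain ⟨s, r, hr, hs⟩ := ((ContDiffMapSupportedIn.withSeminorms ℝ ℝ ℂ ⊤ K).mem_nhds_iff _ _).1 hU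
  -- `s.sup id` is the largest order among the seminorms used; halving `r` turns a non-strict bound
  -- into membership of an open ball.
  refine ⟨s.sup id, r / 2, half_pos hr, fun f hf hfK hfb => ?_⟩
  let F : ContDiffMapSupportedIn ℝ ℂ ⊤ K := .of_support_subset hf hfK
  have hF : F ∈ (s.sup (ContDiffMapSupportedIn.seminorm ℝ ℝ ℂ ⊤ K)).ball 0 r := by
    rw [Seminorm.mem_ball, sub_zero]
    refine Seminorm.finset_sup_apply_lt hr fun i hi => ?_
    refine lt_of_le_of_lt ?_ (half_lt_self hr)
    rw [ContDiffMapSupportedIn.seminorm_top_le_iff ℝ (half_pos hr).le]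
    exact fun x _ => hfb i (Finset.le_sup (f := id) hi) x
  have hmem := hs hF
  have hm : MemLp (renewalError ρ f) 2 (weighted ω) := h (TestFunction.ofSupportedIn hK F)
  refine ⟨hm, ?_⟩
  have hz := toLp_eq_zero_of_eq_zero
    (h (TestFunction.ofSupportedIn hK (0 : ContDiffMapSupportedIn ℝ ℂ ⊤ K))) h0
  rw [Set.mem_preimage, Function.comp_apply, Function.comp_apply, hz,
    mem_closedBall_zero_iff, Lp.norm_toLp] at hmem
  exact (ENNReal.le_ofReal_iff_toReal_le hm.2.ne zero_le_one).2 hmem |>.trans_eq ENNReal.ofReal_one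

lemma integral_mul_sq_le_one_of_eLpNorm_weighted_le_one {ω : ℝ → ℝ} (hω : Continuous ω) (h1 : ∀ x, 1 ≤ ω x)
    {g : ℝ → ℂ} (hg : MemLp g 2 (weighted ω)) (hg1 : eLpNorm g 2 (weighted ω) ≤ 1) :
    Integrable (fun x => ω x * ‖g x‖ ^ 2) ∧ ∫ x, ω x * ‖g x‖ ^ 2 ≤ 1 := by
  have hm : AEMeasurable (fun x => ENNReal.ofReal (ω x)) volume := by fun_prop
  have hlt : ∀ᵐ x : ℝ, ENNReal.ofReal (ω x) < ∞ := ae_of_all _ fun x => ENNReal.ofReal_lt_top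
  have htr : ∀ x, (ENNReal.ofReal (ω x)).toReal = ω x := fun x =>
    ENNReal.toReal_ofReal (zero_le_one.trans (h1 x))
  have hsq := (memLp_two_iff_integrable_sq_norm hg.1).1 hg
  have hint : Integrable (fun x => ω x * ‖g x‖ ^ 2) := by
    have := (integrable_withDensity_iff_integrable_smul₀' hm hlt).1 hsq
    simpa [htr, smul_eq_mul] using this
  refine ⟨hint, ?_⟩
  have h2 : ∫ x, ω x * ‖g x‖ ^ 2 = ∫ x, ‖g x‖ ^ 2 ∂(weighted ω) := by
    rw [weighted, integral_withDensity_eq_integral_toReal_smul₀ hm hlt]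
    simp [htr, smul_eq_mul]
  rw [h2]
  have h3 := hg.eLpNorm_eq_integral_rpow_norm two_ne_zero ENNReal.ofNat_ne_top
  rw [h3] at hg1
  have h4 := (ENNReal.ofReal_le_one).1 hg1
  have h5 : 0 ≤ ∫ x, ‖g x‖ ^ 2 ∂(weighted ω) := integral_nonneg fun x => by positivity
  simp only [ENNReal.toReal_ofNat, Real.rpow_ofNat] at h4
  by_contra! hcon
  exact absurd h4 (not_le.2 (Real.one_lt_rpow hcon (by norm_num)))

/-- A weight that beats `x ^ (2 m)` at infinity dominates a multiple of `(1 + x ^ 2) ^ m`. -/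
lemma IsWeight.exists_mul_pow_le {ω : ℝ → ℝ} (hω : IsWeight ω) {m : ℕ} {c : ℝ} (hc : 0 < c)
    (h : ∀ᶠ x in atTop, c * x ^ (2 * m) ≤ ω x) :
    ∃ c' > 0, ∀ x, c' * (1 + x ^ 2) ^ m ≤ ω x := by
  obtain ⟨X, hX⟩ := eventually_atTop.1 (h.and (eventually_ge_atTop 1))
  have habs : ∀ x, ω |x| = ω x := fun x => by
    rcases abs_choice x with hx | hx <;> rw [hx]
    exact hω.even x
  -- The first constant serves `|x| ≥ X`, where `1 + x ^ 2 ≤ 2 x ^ 2`; the second serves `|x| ≤ X`,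
  -- where `ω ≥ 1` suffices.
  refine ⟨min (c / 2 ^ m) (1 / (1 + X ^ 2) ^ m), by positivity, fun x => ?_⟩
  rcases le_total X |x| with hx | hx
  · obtain ⟨h1, h2⟩ := hX _ hx
    rw [habs] at h1
    have h3 : (1 + x ^ 2) ^ m ≤ 2 ^ m * |x| ^ (2 * m) := by
      rw [pow_mul, ← mul_pow, sq_abs]
      have : 1 ≤ x ^ 2 := by rw [← sq_abs]; exact one_le_pow₀ h2
      gcongr
      linarith
    calc _ ≤ c / 2 ^ m * (2 ^ m * |x| ^ (2 * m)) := by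
          gcongr
          exact min_le_left _ _
      _ = c * |x| ^ (2 * m) := by field_simp
      _ ≤ _ := h1
  · have h3 : (1 + x ^ 2) ^ m ≤ (1 + X ^ 2) ^ m := by
      rw [← sq_abs x]
      gcongr
    calc _ ≤ 1 / (1 + X ^ 2) ^ m * (1 + X ^ 2) ^ m := by
          gcongr
          exact min_le_right _ _
      _ = 1 := by field_simp
      _ ≤ _ := hω.one_le x

/-- Functions in the unit ball of a space with a rapidly growing weight have uniformly bounded
absolute moments. -/
lemma IsWeight.exists_moment_bound {ω : ℝ → ℝ} (hω : IsWeight ω)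
    (hgrow : ∀ m : ℕ, ∃ c > 0, ∀ᶠ x in atTop, c * x ^ m ≤ ω x) (q : ℕ) :
    ∃ M, ∀ g : ℝ → ℂ, MemLp g 2 (weighted ω) → eLpNorm g 2 (weighted ω) ≤ 1 →
      Integrable (fun x : ℝ => (x : ℂ) ^ q * g x) ∧ ∫ x, |x| ^ q * ‖g x‖ ≤ M := by
  -- `q` factors `1 + x ^ 2` absorb the squared moment weight; the extra one pays for the integrable
  -- function `(1 + x ^ 2)⁻¹` in the arithmetic-geometric inequality below.
  obtain ⟨c₀, hc₀, h₀⟩ := hgrow (2 * (q + 1))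
  obtain ⟨c, hc, hle⟩ := hω.exists_mul_pow_le hc₀ h₀
  refine ⟨(∫ x : ℝ, c⁻¹ * (1 + x ^ 2)⁻¹) + 1, fun g hg hg1 => ?_⟩
  obtain ⟨hi, hi1⟩ := integral_mul_sq_le_one_of_eLpNorm_weighted_le_one hω.continuous hω.one_le hg hg1
  have hc1 : Integrable fun x : ℝ => c⁻¹ * (1 + x ^ 2)⁻¹ := integrable_inv_one_add_sq.const_mul _
  have hpt : ∀ x, |x| ^ q * ‖g x‖ ≤ c⁻¹ * (1 + x ^ 2)⁻¹ + ω x * ‖g x‖ ^ 2 := by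
    intro x
    have h1 : |x| ^ q * ‖g x‖ ≤ c⁻¹ * (1 + x ^ 2)⁻¹ + c * (1 + x ^ 2) ^ (q + 1) * ‖g x‖ ^ 2 := by
      refine abs_le_of_sq_le_sq' ?_ (by positivity) |>.2
      have h2 : (|x| ^ q * ‖g x‖) ^ 2 ≤
          (c⁻¹ * (1 + x ^ 2)⁻¹) * (c * (1 + x ^ 2) ^ (q + 1) * ‖g x‖ ^ 2) := by
        have h3 : (|x| ^ q * ‖g x‖) ^ 2 = (x ^ 2) ^ q * ‖g x‖ ^ 2 := by
          rw [mul_pow, ← pow_mul, mul_comm q, pow_mul, sq_abs]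
        have h4 : (c⁻¹ * (1 + x ^ 2)⁻¹) * (c * (1 + x ^ 2) ^ (q + 1) * ‖g x‖ ^ 2) =
            (1 + x ^ 2) ^ q * ‖g x‖ ^ 2 := by
          have : (1 + x ^ 2) ≠ 0 := by positivity
          field_simp
          ring
        rw [h3, h4]
        gcongr
        linarith
      refine h2.trans ?_
      have ha : 0 ≤ c⁻¹ * (1 + x ^ 2)⁻¹ := by positivity
      have hb : 0 ≤ c * (1 + x ^ 2) ^ (q + 1) * ‖g x‖ ^ 2 := by positivity
      nlinarith [mul_nonneg ha hb, sq_nonneg (c⁻¹ * (1 + x ^ 2)⁻¹),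
        sq_nonneg (c * (1 + x ^ 2) ^ (q + 1) * ‖g x‖ ^ 2)]
    refine h1.trans (add_le_add le_rfl ?_)
    gcongr
    exact hle x
  have hac : volume ≪ weighted ω := by
    refine withDensity_absolutelyContinuous' (by have := hω.continuous; fun_prop) ?_
    exact ae_of_all _ fun x => by simpa using zero_lt_one.trans_le (hω.one_le x)
  have hgm : AEStronglyMeasurable g volume := hg.1.mono_ac hac
  have hint : Integrable (fun x : ℝ => (x : ℂ) ^ q * g x) := by
    refine (hc1.add hi).mono' (AEStronglyMeasurable.mul (by fun_prop) hgm) (ae_of_all _ fun x => ?_)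
    simpa using hpt x
  refine ⟨hint, ?_⟩
  have hint' : Integrable fun x => |x| ^ q * ‖g x‖ := by simpa using hint.norm
  calc ∫ x, |x| ^ q * ‖g x‖ ≤ ∫ x, (c⁻¹ * (1 + x ^ 2)⁻¹ + ω x * ‖g x‖ ^ 2) :=
        integral_mono hint' (hc1.add hi) hpt
    _ = (∫ x : ℝ, c⁻¹ * (1 + x ^ 2)⁻¹) + ∫ x, ω x * ‖g x‖ ^ 2 := integral_add hc1 hi
    _ ≤ _ := by gcongr

end Renewal

/-! ### The symbol `1 - ρ̂` and renewal solutions on the Fourier side. -/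

namespace Renewal

/-- `1 - ∫ exp (-i s y) dρ(y)`, written with the reflected measure. -/
noncomputable def charDefect (ρ : Measure ℝ) (s : ℝ) : ℂ :=
  1 - fourierInt (ρ.map fun y : ℝ => -y) (fun _ => 1) s

lemma charDefect_eq_one_sub_laplace (ρ : Measure ℝ) (s : ℝ) :
    charDefect ρ s = 1 - laplace ρ (Complex.I * (s : ℂ)) := by
  rw [charDefect, fourierInt, laplace, integral_map (by fun_prop) (by fun_prop)]
  simp

/-- Multiplication by a character commutes with convolution, and the integral of a convolution is
the product of the integrals. -/
lemma fourierInt_eq_add_of_renewal {ν : Measure ℝ} [IsFiniteMeasure ν] {u f : ℝ → ℂ}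
    (hu : Integrable u) (hf : Integrable f) (h : ∀ x, u x = f x + ∫ z, u (x - z) ∂ν) (s : ℝ) :
    fourierInt volume u s = fourierInt volume f s +
      fourierInt ν (fun _ => 1) s * fourierInt volume u s := by
  have hexp : ∀ s : ℝ, Continuous fun x : ℝ => Complex.exp (Complex.I * s * x) := by
    intro s; fun_prop
  have hmul : ∀ {μ : Measure ℝ} {v : ℝ → ℂ}, Integrable v μ →
      Integrable (fun x => v x * Complex.exp (Complex.I * s * x)) μ := fun hv => by
    refine hv.mono (hv.1.mul (hexp s).aestronglyMeasurable) (ae_of_all _ fun x => ?_)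
    rw [norm_mul, norm_exp_I_mul_mul, mul_one]
  have h1 := hmul (integrable_const (1 : ℂ) (μ := ν))
  have hconv := integral_convolution (ContinuousLinearMap.mul ℂ ℂ) h1 (hmul hu)
  have hci : ∀ x, (fun x => u x * Complex.exp (Complex.I * s * x)) x =
      f x * Complex.exp (Complex.I * s * x) + convolution
        (fun x : ℝ => 1 * Complex.exp (Complex.I * s * x))
        (fun x => u x * Complex.exp (Complex.I * s * x)) (ContinuousLinearMap.mul ℂ ℂ) ν x := by
    intro x
    simp only [convolution, ContinuousLinearMap.mul_apply', one_mul]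
    conv_lhs => rw [h x]
    rw [add_mul, ← integral_mul_const]
    congr 2
    funext z
    rw [mul_left_comm, ← Complex.exp_add]
    congr 2
    push_cast
    ring
  have hconvi : Integrable (convolution (fun x : ℝ => 1 * Complex.exp (Complex.I * s * x))
      (fun x => u x * Complex.exp (Complex.I * s * x)) (ContinuousLinearMap.mul ℂ ℂ) ν) :=
    (h1.convolution_integrand (ContinuousLinearMap.mul ℂ ℂ) (hmul hu)).integral_prod_left
  simp only [fourierInt]
  refine (integral_congr_ae (ae_of_all _ hci)).trans ?_
  rw [integral_add (hmul hf) hconvi, hconv]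
  rfl

lemma HasExpMoment.hasMoments_map_neg {ρ : Measure ℝ} (hexp : HasExpMoment ρ) :
    HasMoments (ρ.map fun y : ℝ => -y) fun _ => 1 := by
  obtain ⟨η, hη, hint⟩ := hexp
  intro n
  rw [integrable_map_measure (by fun_prop) (by fun_prop)]
  refine (hint.const_mul ((n.factorial : ℝ) / η ^ n)).mono' (by fun_prop) (ae_of_all _ fun y => ?_)
  simp only [Function.comp_apply, mul_one, norm_pow, Complex.norm_real, norm_neg, Real.norm_eq_abs]
  have := Real.pow_div_factorial_le_exp (η * |y|) (by positivity) n
  rw [div_le_iff₀ (by positivity), mul_pow] at this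
  rw [div_mul_eq_mul_div, le_div_iff₀ (by positivity)]
  linarith

lemma contDiff_charDefect {ρ : Measure ℝ} (hexp : HasExpMoment ρ) (n : ℕ) :
    ContDiff ℝ n (charDefect ρ) :=
  contDiff_const.sub (hexp.hasMoments_map_neg.contDiff_fourierInt n)

lemma norm_iteratedDeriv_charDefect_le {ρ : Measure ℝ} (hexp : HasExpMoment ρ) (n : ℕ) :
    ∃ C, ∀ s, ‖iteratedDeriv n (charDefect ρ) s‖ ≤ C := by
  have hm := hexp.hasMoments_map_neg
  refine ⟨1 + ∫ x, |x| ^ n * ‖(1 : ℂ)‖ ∂(ρ.map fun y : ℝ => -y), fun s => ?_⟩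
  have h1 : iteratedDeriv n (charDefect ρ) s = iteratedDeriv n (fun _ : ℝ => (1 : ℂ)) s -
      iteratedDeriv n (fourierInt (ρ.map fun y : ℝ => -y) fun _ => 1) s :=
    iteratedDeriv_fun_sub contDiffAt_const (hm.contDiff_fourierInt n).contDiffAt
  rw [h1]
  refine (norm_sub_le _ _).trans (add_le_add ?_ (hm.norm_iteratedDeriv_fourierInt_le n s))
  rw [iteratedDeriv_const]
  split_ifs <;> simp

/-- Where the characteristic function is close to one, its derivative is close to its value at
the origin. -/
lemma tendsto_deriv_charDefect {ρ : Measure ℝ} [IsProbabilityMeasure ρ] (hexp : HasExpMoment ρ)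
    {l : Filter ℝ} (hl : Tendsto (charDefect ρ) l (𝓝 0)) :
    Tendsto (deriv (charDefect ρ)) l (𝓝 (Complex.I * drift ρ)) := by
  set ν := ρ.map fun y : ℝ => -y with hν
  have hm : HasMoments ν fun _ => 1 := hexp.hasMoments_map_neg
  have hexpc : ∀ s : ℝ, Continuous fun x : ℝ => Complex.exp (Complex.I * s * x) := by
    intro s; fun_prop
  have hm1 : Integrable (fun x : ℝ => (x : ℂ)) ν := by simpa using hm 1
  have hm2 : Integrable (fun x : ℝ => x ^ 2) ν := by
    simpa using (hm 2).norm
  set m₂ := ∫ x, x ^ 2 ∂ν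
  have hm₂ : 0 ≤ m₂ := integral_nonneg fun x => by positivity
  have hxe : ∀ s : ℝ, Integrable (fun x : ℝ => (x : ℂ) * Complex.exp (Complex.I * s * x)) ν := by
    intro s
    refine hm1.mono (hm1.1.mul (hexpc s).aestronglyMeasurable) (ae_of_all _ fun x => ?_)
    rw [norm_mul, norm_exp_I_mul_mul, mul_one]
  have he : ∀ s : ℝ, Integrable (fun x : ℝ => Complex.exp (Complex.I * s * x)) ν := by
    intro s
    refine (integrable_const (1 : ℂ)).mono (hexpc s).aestronglyMeasurable (ae_of_all _ fun x => ?_)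
    rw [norm_exp_I_mul_mul, norm_one]
  have hmean : ∫ x : ℝ, (x : ℂ) ∂ν = -(drift ρ : ℂ) := by
    rw [integral_complex_ofReal, hν, integral_map (by fun_prop) (by fun_prop), integral_neg, drift]
    push_cast
    rfl
  have hderiv : ∀ s, deriv (charDefect ρ) s - Complex.I * drift ρ =
      -Complex.I * ∫ x : ℝ, (x : ℂ) * (Complex.exp (Complex.I * s * x) - 1) ∂ν := by
    intro s
    have h1 : HasDerivAt (charDefect ρ) _ s := (hm.hasDerivAt_fourierInt s).const_sub 1
    rw [h1.deriv]
    simp_rw [mul_sub, mul_one, fourierInt, mul_assoc Complex.I, integral_const_mul]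
    simp_rw [← mul_assoc Complex.I]
    rw [integral_sub (hxe s) hm1, hmean]
    ring
  -- As `|e^{iθ} - 1|² = 2 Re (1 - e^{iθ})`, a small defect forces `e^{isx}` to be close to 1 in
  -- `L²(ν)`.
  have hD : ∀ s : ℝ, ∫ x : ℝ, ‖Complex.exp (Complex.I * s * x) - 1‖ ^ 2 ∂ν =
      2 * (charDefect ρ s).re := by
    intro s
    have h1 : ∀ x : ℝ, ‖Complex.exp (Complex.I * s * x) - 1‖ ^ 2 =
        2 * (1 - Complex.exp (Complex.I * s * x)).re := by
      intro x
      have h2 : ‖Complex.exp (Complex.I * s * x)‖ ^ 2 = 1 := by rw [norm_exp_I_mul_mul, one_pow]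
      rw [← Complex.normSq_eq_norm_sq, Complex.normSq_apply] at h2 ⊢
      simp only [Complex.sub_re, Complex.sub_im, Complex.one_re, Complex.one_im]
      linarith
    have h3 : charDefect ρ s = ∫ x : ℝ, (1 - Complex.exp (Complex.I * s * x)) ∂ν := by
      rw [integral_sub (integrable_const _) (he s)]
      simp [charDefect, fourierInt, ← hν]
    simp_rw [h1]
    rw [integral_const_mul, h3]
    congr 1
    exact integral_re ((integrable_const (1 : ℂ)).sub (he s))
  -- Weighted arithmetic-geometric inequality `|x| a ≤ t x² + a² / t`; `t` is later fixed to make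
  -- the second-moment term small before the defect tends to zero.
  have hbound : ∀ s t : ℝ, 0 < t →
      ‖deriv (charDefect ρ) s - Complex.I * drift ρ‖ ≤ t * m₂ + 2 * ‖charDefect ρ s‖ / t := by
    intro s t ht
    have hsq : Integrable (fun x : ℝ => ‖Complex.exp (Complex.I * s * x) - 1‖ ^ 2) ν := by
      refine (integrable_const (4 : ℝ)).mono' (by fun_prop) (ae_of_all _ fun x => ?_)
      have := norm_sub_le (Complex.exp (Complex.I * s * x)) 1
      rw [norm_exp_I_mul_mul, norm_one] at this
      rw [Real.norm_of_nonneg (by positivity)]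
      nlinarith [norm_nonneg (Complex.exp (Complex.I * s * x) - 1)]
    rw [hderiv, norm_mul, norm_neg, Complex.norm_I, one_mul]
    calc _ ≤ ∫ x : ℝ, (t * x ^ 2 + ‖Complex.exp (Complex.I * s * x) - 1‖ ^ 2 / t) ∂ν := by
          refine norm_integral_le_of_norm_le ((hm2.const_mul t).add (hsq.div_const t))
            (ae_of_all _ fun x => ?_)
          rw [norm_mul, Complex.norm_real, Real.norm_eq_abs]
          set a := ‖Complex.exp (Complex.I * s * x) - 1‖
          have h5 : t * x ^ 2 + a ^ 2 / t - |x| * a =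
              ((t * |x| - a) ^ 2 + t * |x| * a) / t := by
            rw [← sq_abs x]; field_simp; ring
          have h6 : 0 ≤ ((t * |x| - a) ^ 2 + t * |x| * a) / t := by positivity
          linarith
      _ = t * m₂ + 2 * (charDefect ρ s).re / t := by
          rw [integral_add (hm2.const_mul t) (hsq.div_const t), integral_const_mul,
            integral_div, hD]
      _ ≤ _ := by
          gcongr
          exact Complex.re_le_norm _
  rw [tendsto_iff_norm_sub_tendsto_zero]
  refine tendsto_order.2 ⟨fun a ha => Eventually.of_forall fun s =>
    ha.trans_le (norm_nonneg _), fun ε hε => ?_⟩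
  set t := ε / (2 * (m₂ + 1)) with ht
  have htpos : 0 < t := by positivity
  have htm : t * m₂ < ε / 2 := by
    rw [ht, div_mul_eq_mul_div, div_lt_div_iff₀ (by positivity) two_pos]
    nlinarith
  have hlim : Tendsto (fun s => 2 * ‖charDefect ρ s‖ / t) l (𝓝 0) := by
    simpa using (hl.norm.const_mul 2).div_const t
  filter_upwards [hlim.eventually (gt_mem_nhds (half_pos hε))] with s hs
  linarith [hbound s t htpos]

/-- Renewal solutions with modulated data: uniform control of all moments, for data that decay
only like a fixed power of the frequency. -/
lemma exists_renewal_solution {ρ : Measure ℝ} [IsProbabilityMeasure ρ]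
    (hexp : HasExpMoment ρ) (hdrift : HasDrift ρ) {ω : ℝ → ℝ} (hω : IsWeight ω)
    (hcont : IsContinuousIntoWeightedL2 ρ ω)
    (hgrow : ∀ m : ℕ, ∃ c > 0, ∀ᶠ x in atTop, c * x ^ m ≤ ω x)
    {φ : ℝ → ℂ} (hφ : ContDiff ℝ (⊤ : ℕ∞) φ) (hφc : HasCompactSupport φ) :
    ∃ k : ℕ, ∃ r : ℝ, 0 < r ∧ ∃ M : ℕ → ℝ, ∀ b : ℝ, 1 ≤ |b| → ∃ u : ℝ → ℂ,
      HasMoments volume u ∧ (∀ q, ∫ x, |x| ^ q * ‖u x‖ ≤ M q) ∧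
      charDefect ρ * fourierInt volume u =
        fun s => ((r / |b| ^ (k + 1) : ℝ) : ℂ) * fourierInt volume (deriv (wavePacket φ b)) s := by
  -- All packets share the support of `φ`, so `k` is independent of both `b` and the moment order.
  obtain ⟨k, r₀, hr₀, hk⟩ := hcont.exists_bound ⟨tsupport φ, hφc⟩
  choose C hC using norm_iteratedFDeriv_deriv_wavePacket_le hφ hφc
  choose M₀ hM₀ using hω.exists_moment_bound hgrow
  have hS : 0 < 1 + ∑ i ∈ Finset.range (k + 1), |C i| := by positivity
  set r := r₀ / (1 + ∑ i ∈ Finset.range (k + 1), |C i|) with hr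
  have hrpos : 0 < r := by positivity
  refine ⟨k, r, hrpos, fun q => M₀ q + r / |drift ρ| * ∫ x, |x| ^ q * ‖φ x‖, fun b hb => ?_⟩
  set t : ℝ := r / |b| ^ (k + 1) with ht
  have hb0 : 0 < |b| := zero_lt_one.trans_le hb
  have htpos : 0 < t := by positivity
  have htr : t ≤ r := div_le_self hrpos.le (one_le_pow₀ hb)
  set h : ℝ → ℂ := fun x => (t : ℂ) * wavePacket φ b x with hh
  have hhs : ContDiff ℝ (⊤ : ℕ∞) h := contDiff_const.mul (contDiff_wavePacket hφ b)
  have hhc : HasCompactSupport h := (hasCompactSupport_wavePacket hφc b).mul_left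
  have hdh : ∀ x, deriv h x = (t : ℂ) * deriv (wavePacket φ b) x := fun x =>
    deriv_const_mul _ ((contDiff_wavePacket hφ b).differentiable (by simp) x)
  have hdhs : ContDiff ℝ (⊤ : ℕ∞) (deriv h) := (contDiff_infty_iff_deriv.1 hhs).2
  have hdhc : HasCompactSupport (deriv h) := hhc.deriv
  have hbd : ∀ i ≤ k, ∀ x, ‖iteratedFDeriv ℝ i (deriv h) x‖ ≤ r₀ := by
    intro i hi x
    have h1 : deriv h = (t : ℂ) • deriv (wavePacket φ b) := funext hdh
    have hw : ContDiff ℝ (⊤ : ℕ∞) (deriv (wavePacket φ b)) :=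
      (contDiff_infty_iff_deriv.1 (contDiff_wavePacket hφ b)).2
    rw [h1, iteratedFDeriv_const_smul_apply (hw.of_le (by exact_mod_cast le_top)).contDiffAt,
      norm_smul, Complex.norm_real, Real.norm_of_nonneg htpos.le]
    have h2 : C i ≤ 1 + ∑ i ∈ Finset.range (k + 1), |C i| :=
      ((le_abs_self _).trans (Finset.single_le_sum (f := fun i => |C i|)
        (fun i _ => abs_nonneg _) (Finset.mem_range.2 (Nat.lt_succ_of_le hi)))).trans (by linarith)
    calc _ ≤ t * (C i * |b| ^ (i + 1)) := by gcongr; exact hC i b x hb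
      _ ≤ t * ((1 + ∑ i ∈ Finset.range (k + 1), |C i|) * |b| ^ (k + 1)) := by
          gcongr
      _ = r₀ := by rw [ht, hr]; field_simp
  have hsupp : Function.support (deriv h) ⊆ tsupport φ := by
    refine support_deriv_subset.trans (closure_mono fun x hx => ?_)
    rw [Function.mem_support] at hx ⊢
    contrapose! hx
    simp [hh, wavePacket, hx]
  obtain ⟨hmem, hle⟩ := hk (deriv h) hdhs hsupp hbd
  set u : ℝ → ℂ := fun x => ∫ y, deriv h (x - y) ∂(green ρ) with hu
  -- The data being `h'`, the limit kernel contributes only `-h / λ`, so the moments of the error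
  -- pass to `u`.
  have hug : ∀ x, u x = renewalError ρ (deriv h) x - h x / drift ρ := by
    intro x
    rw [renewalError, limitKernel_conv_deriv hdrift.2 (hhs.of_le (by exact_mod_cast le_top)) hhc]
    ring
  have hhm := hasMoments_of_hasCompactSupport hhs.continuous hhc
  have hum : HasMoments volume u := by
    intro n
    refine (((hM₀ n _ hmem hle).1).sub ((hhm n).div_const (drift ρ : ℂ))).congr
      (ae_of_all _ fun x => ?_)
    simp only [Pi.sub_apply, hug x]
    ring
  refine ⟨u, hum, fun q => ?_, ?_⟩
  · have hi1 : Integrable fun x => |x| ^ q * ‖renewalError ρ (deriv h) x‖ := by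
      simpa using (hM₀ q _ hmem hle).1.norm
    have hi2 := (integrable_pow_mul_norm hφ.continuous hφc q).const_mul (r / |drift ρ|)
    calc ∫ x, |x| ^ q * ‖u x‖ ≤ ∫ x, (|x| ^ q * ‖renewalError ρ (deriv h) x‖ +
          r / |drift ρ| * (|x| ^ q * ‖φ x‖)) := by
          refine integral_mono (by simpa using (hum q).norm) (hi1.add hi2) fun x => ?_
          have h3 : ‖u x‖ ≤ ‖renewalError ρ (deriv h) x‖ + r / |drift ρ| * ‖φ x‖ := by
            rw [hug]
            refine (norm_sub_le _ _).trans (add_le_add le_rfl ?_)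
            rw [norm_div, hh, norm_mul, wavePacket, norm_mul, norm_exp_I_mul_mul, one_mul,
              Complex.norm_real, Complex.norm_real, Real.norm_of_nonneg htpos.le,
              Real.norm_eq_abs, div_mul_eq_mul_div r |drift ρ|]
            gcongr
          calc _ ≤ |x| ^ q * (‖renewalError ρ (deriv h) x‖ + r / |drift ρ| * ‖φ x‖) := by gcongr
            _ = _ := by ring
      _ = (∫ x, |x| ^ q * ‖renewalError ρ (deriv h) x‖) +
          r / |drift ρ| * ∫ x, |x| ^ q * ‖φ x‖ := by
          rw [integral_add hi1 hi2, integral_const_mul]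
      _ ≤ _ := add_le_add (hM₀ q _ hmem hle).2 le_rfl
  · funext s
    have h4 := fourierInt_eq_add_of_renewal (ν := ρ.map fun y : ℝ => -y) hum.integrable
      (hdhs.continuous.integrable_of_hasCompactSupport hdhc)
      (fun x => green_conv_sub hexp hdrift hdhs.continuous hdhc x) s
    have h5 : fourierInt volume (deriv h) s =
        (t : ℂ) * fourierInt volume (deriv (wavePacket φ b)) s := by
      simp_rw [fourierInt, hdh, mul_assoc, integral_const_mul]
    rw [Pi.mul_apply, ← h5, charDefect, sub_mul, one_mul]
    exact sub_eq_of_eq_add h4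

end Renewal

/-! ### Frequencies violating the diophantine condition, and the conclusion. -/

namespace Renewal

lemma exists_smooth_bump : ∃ φ : ℝ → ℂ, ContDiff ℝ (⊤ : ℕ∞) φ ∧ HasCompactSupport φ ∧
    ∫ x, φ x ≠ 0 := by
  let f : ContDiffBump (0 : ℝ) := ⟨1, 2, one_pos, one_lt_two⟩
  refine ⟨fun x => (f x : ℂ), Complex.ofRealCLM.contDiff.comp f.contDiff,
    f.hasCompactSupport.comp_left Complex.ofReal_zero, ?_⟩
  rw [integral_complex_ofReal]
  exact_mod_cast (f.integral_pos (μ := volume)).ne'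

lemma exists_mul_pow_le_of_liminf_ne_zero {ω : ℝ → ℝ} {p : ℕ}
    (h : liminf (fun x : ℝ => ENNReal.ofReal (ω x / x ^ p)) atTop ≠ 0) :
    ∃ c > 0, ∀ᶠ x in atTop, c * x ^ p ≤ ω x := by
  obtain ⟨c, hc0, hc⟩ := exists_between (pos_iff_ne_zero.2 h)
  refine ⟨c.toReal, ENNReal.toReal_pos hc0.ne' hc.ne_top, ?_⟩
  filter_upwards [eventually_lt_of_lt_liminf hc, eventually_gt_atTop 0] with x hx hx0
  exact (le_div_iff₀ (pow_pos hx0 p)).1 (ENNReal.toReal_lt_of_lt_ofReal hx).le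

/-- If the diophantine condition of order `l` fails, there is a filter of frequencies tending to
infinity along which `|b| ^ l * ‖1 - ρ̂(i b)‖` tends to zero. -/
lemma exists_filter_of_not_isWeaklyDiophantineOfOrder {ρ : Measure ℝ} {l : ℝ}
    (h : ¬ IsWeaklyDiophantineOfOrder ρ l) :
    ∃ F : Filter ℝ, F.NeBot ∧ Tendsto (fun b : ℝ => |b|) F atTop ∧
      Tendsto (fun b : ℝ => |b| ^ l * ‖charDefect ρ b‖) F (𝓝 0) := by
  refine ⟨(atBot ⊔ atTop) ⊓ comap (fun b : ℝ => |b| ^ l * ‖charDefect ρ b‖) (𝓝 0), ?_,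
    (tendsto_abs_atBot_atTop.sup tendsto_abs_atTop_atTop).mono_left inf_le_left,
    tendsto_comap.mono_left inf_le_right⟩
  -- The filter is nontrivial exactly because 0 is a cluster point of the quantity at infinity.
  rw [neBot_inf_comap_iff_map, inf_comm]
  refine mapClusterPt_iff_frequently.2 fun s hs => ?_
  obtain ⟨ε, hε, hεs⟩ := Metric.mem_nhds_iff.1 hs
  have hlt : liminf (fun b : ℝ => ENNReal.ofReal (|b| ^ l *
      ‖1 - laplace ρ (Complex.I * (b : ℂ))‖)) (atBot ⊔ atTop) < ENNReal.ofReal ε :=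
    (not_lt.1 h).trans_lt (ENNReal.ofReal_pos.2 hε)
  refine (frequently_lt_of_liminf_lt (by isBoundedDefault) hlt).mono fun b hb => hεs ?_
  rw [← charDefect_eq_one_sub_laplace, ENNReal.ofReal_lt_ofReal_iff hε] at hb
  rwa [mem_ball_zero_iff, Real.norm_of_nonneg (by positivity)]

end Renewal

theorem mainTheorem4 (ρ : Measure ℝ) [IsProbabilityMeasure ρ]
    (hexp : Renewal.HasExpMoment ρ) (hdrift : Renewal.HasDrift ρ)
    (hwd : Renewal.IsWeaklyDiophantine ρ)
    (hnot : ∃ l : ℝ, 0 < l ∧ ¬ Renewal.IsWeaklyDiophantineOfOrder ρ l)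
    (ω : ℝ → ℝ) (hω : Renewal.IsWeight ω)
    (hcont : Renewal.IsContinuousIntoWeightedL2 ρ ω) :
    ∃ p : ℕ, liminf (fun x : ℝ => ENNReal.ofReal (ω x / x ^ p)) atTop = 0 := by
  by_contra! hcon
  obtain ⟨l, hl, hnl⟩ := hnot
  obtain ⟨φ, hφ, hφc, hφi⟩ := Renewal.exists_smooth_bump
  obtain ⟨k, r, hr, M, hsol⟩ := Renewal.exists_renewal_solution hexp hdrift hω hcont
    (fun m => Renewal.exists_mul_pow_le_of_liminf_ne_zero (hcon m)) hφ hφc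
  obtain ⟨𝓕, hne, habs, hv⟩ := Renewal.exists_filter_of_not_isWeaklyDiophantineOfOrder hnl
  choose! u hum huM hu using hsol
  have h1 : ∀ᶠ b in 𝓕, 1 ≤ |b| := habs.eventually_ge_atTop 1
  have hD0 : Tendsto (Renewal.charDefect ρ) 𝓕 (𝓝 0) := by
    refine squeeze_zero_norm' ?_ hv
    filter_upwards [h1] with b hb
    exact le_mul_of_one_le_left (norm_nonneg _) (Real.one_le_rpow hb hl.le)
  have hw : ∀ b, Renewal.HasMoments volume (deriv (Renewal.wavePacket φ b)) := fun b =>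
    Renewal.hasMoments_of_hasCompactSupport
      (Renewal.continuous_deriv_of_contDiff (Renewal.contDiff_wavePacket hφ b))
      (Renewal.hasCompactSupport_wavePacket hφc b).deriv
  have hFnorm : ∀ b : ℝ, 1 ≤ |b| → ‖((r / |b| ^ (k + 1) : ℝ) : ℂ) *
      Renewal.fourierInt volume (deriv (Renewal.wavePacket φ b)) b‖ =
        r / |b| ^ (k + 1) * (|b| * ‖∫ x, φ x‖) := by
    intro b hb
    rw [Renewal.fourierInt_deriv_wavePacket hφ hφc, norm_mul, norm_mul, norm_neg, norm_mul,
      Complex.norm_I, one_mul, Complex.norm_real, Complex.norm_real, Real.norm_eq_abs b,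
      Real.norm_of_nonneg (by positivity)]
  have hφpos : 0 < ‖∫ x, φ x‖ := norm_pos_iff.2 hφi
  -- With `n l ≥ k`, the power `(|b| ^ l) ^ (n + 1)` absorbs the loss `|b| ^ k` coming from `1 /
  -- F(b)`.
  set n := ⌈(k : ℝ) / l⌉₊ with hn
  obtain ⟨L, hL0, hL⟩ := Renewal.tendsto_pow_mul_iteratedDeriv_div
    (l := 𝓕) (D := Renewal.charDefect ρ) (U := fun b => Renewal.fourierInt volume (u b))
    (F := fun b s => ((r / |b| ^ (k + 1) : ℝ) : ℂ) *
      Renewal.fourierInt volume (deriv (Renewal.wavePacket φ b)) s)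
    (d := Complex.I * Renewal.drift ρ)
    (mul_ne_zero Complex.I_ne_zero (Complex.ofReal_ne_zero.2 hdrift.2))
    (Renewal.contDiff_charDefect hexp)
    (h1.mono fun b hb => (hum b hb).contDiff_fourierInt) (h1.mono hu)
    (by
      filter_upwards [h1] with b hb
      have hb0 : 0 < |b| := zero_lt_one.trans_le hb
      rw [← norm_pos_iff, hFnorm b hb]
      positivity)
    hD0 (Renewal.tendsto_deriv_charDefect hexp hD0)
    (Renewal.norm_iteratedDeriv_charDefect_le hexp)
    (by
      intro j
      obtain ⟨C, hC⟩ := Renewal.integral_pow_mul_norm_deriv_wavePacket_le hφ hφc j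
      refine ⟨C / ‖∫ x, φ x‖, ?_⟩
      filter_upwards [h1] with b hb
      have hb0 : 0 < |b| := zero_lt_one.trans_le hb
      rw [norm_div, hFnorm b hb, iteratedDeriv_const_mul_field, norm_mul, Complex.norm_real,
        Real.norm_of_nonneg (by positivity), mul_div_mul_left _ _ (by positivity),
        div_le_div_iff₀ (by positivity) hφpos]
      have := ((hw b).norm_iteratedDeriv_fourierInt_le j b).trans (hC b hb)
      calc _ ≤ C * |b| * ‖∫ x, φ x‖ := by gcongr
        _ = _ := by ring)
    n
  -- The uniform moment bound makes the same quantity tend to 0, although its limit `L` is nonzero.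
  refine hL0 (tendsto_nhds_unique hL (squeeze_zero_norm' (a := fun b =>
    M n / (r * ‖∫ x, φ x‖) * (|b| ^ l * ‖Renewal.charDefect ρ b‖) ^ (n + 1)) ?_ ?_))
  · filter_upwards [h1] with b hb
    have hb0 : 0 < |b| := zero_lt_one.trans_le hb
    have hU := ((hum b hb).norm_iteratedDeriv_fourierInt_le n b).trans (huM b hb n)
    have hM : 0 ≤ M n := (norm_nonneg _).trans hU
    have hpow : |b| ^ k ≤ (|b| ^ l) ^ (n + 1) := by
      rw [← Real.rpow_natCast, ← Real.rpow_natCast, ← Real.rpow_mul hb0.le]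
      refine Real.rpow_le_rpow_of_exponent_le hb ?_
      have := (div_le_iff₀ hl).1 (Nat.le_ceil ((k : ℝ) / l))
      rw [← hn] at this
      push_cast
      nlinarith
    rw [norm_div, hFnorm b hb, norm_mul, norm_pow]
    calc _ ≤ ‖Renewal.charDefect ρ b‖ ^ (n + 1) * M n /
          (r / |b| ^ (k + 1) * (|b| * ‖∫ x, φ x‖)) := by gcongr
      _ = M n / (r * ‖∫ x, φ x‖) * (|b| ^ k * ‖Renewal.charDefect ρ b‖ ^ (n + 1)) := by
          field_simp
          ring
      _ ≤ _ := by
          rw [mul_pow]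
          gcongr
  · simpa using (hv.pow (n + 1)).const_mul (M n / (r * ‖∫ x, φ x‖))
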